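/- Let $\mathbb{Z}\langle X\rangle$ be the free unital associative ring freely generated by the countably infinite set $X=\{x_1,x_2,\dots\}$. Put $[a,b]=ab-ba$, $[a,b,c]=[[a,b],c]$ and $[a,b,c,d]=[[[a,b],c],d]$, and let $T^{(4)}$ be the two-sided ideal of $\mathbb{Z}\langle X\rangle$ generated by all commutators $[a_1,a_2,a_3,a_4]$ with $a_1,a_2,a_3,a_4\in\mathbb{Z}\langle X\rangle$. For $k\ge 1$ let $$v_k=[x_1,x_2]\,[x_3,x_4]\cdots[x_{2k-1},x_{2k}]\,[x_{2k+1},x_{2k+2},x_{2k+3}].$$ Then, for every $k\ge 1$, $v_k\notin T^{(4)}$ and $3v_k\in T^{(4)}$; consequently the image of $v_k$ in the additive group of $\mathbb{Z}\langle X\rangle/T^{(4)}$ is an element of order exactly $3$. -/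

import Mathlib

noncomputable section

namespace LieNilpotent

/-- The free unital associative ring `ℤ⟨X⟩` on the countable set `X = {x₁, x₂, …}`,
indexed by the positive integers. -/
abbrev FreeRing : Type := FreeAlgebra ℤ ℕ+

/-- The free generator `x_i`, `i ≥ 1`. -/
def x (i : ℕ+) : FreeRing := FreeAlgebra.ι ℤ i

/-- The two-sided ideal `T⁽⁴⁾` generated by all left-normed commutators
`[a₁, a₂, a₃, a₄] = [[[a₁, a₂], a₃], a₄]` with arbitrary `aᵢ ∈ ℤ⟨X⟩`,
where `⁅a, b⁆ = a * b - b * a`. -/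
def T4 : TwoSidedIdeal FreeRing :=
  TwoSidedIdeal.span {f | ∃ a₁ a₂ a₃ a₄ : FreeRing, f = ⁅⁅⁅a₁, a₂⁆, a₃⁆, a₄⁆}

/-- `v_k = [x₁, x₂] [x₃, x₄] ⋯ [x_{2k-1}, x_{2k}] [x_{2k+1}, x_{2k+2}, x_{2k+3}]`, the factors
multiplied in this order. Here `Nat.succPNat n` is the positive integer `n + 1`. -/
def v (k : ℕ) : FreeRing :=
  ((List.range k).map fun i => ⁅x (Nat.succPNat (2 * i)), x (Nat.succPNat (2 * i + 1))⁆).prod *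
    ⁅⁅x (Nat.succPNat (2 * k)), x (Nat.succPNat (2 * k + 1))⁆, x (Nat.succPNat (2 * k + 2))⁆

end LieNilpotent

end

/-!
The two halves of the claim are independent.

**Torsion.** In a ring satisfying `⁅⁅⁅a, b⁆, c⁆, d⁆ = 0` the triple commutators are central.
Expanding `⁅⁅⁅c, d⁆, b * e⁆, a⁆ = 0` and `⁅⁅⁅a * c, b⁆, d⁆, e⁆ = 0` shows that
`⁅a, b⁆ * ⁅⁅c, d⁆, e⁆` changes sign under a set of transpositions generating all permutations of
its five arguments. The three terms of the Jacobi identity for `c, d, e` are then equal, so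
`3 * (⁅a, b⁆ * ⁅⁅c, d⁆, e⁆) = 0` (`three_mul_lie_mul_lie_lie`).

**Nonvanishing.** It suffices to find a homomorphism from the free ring to some ring `B` that
kills all fourfold commutators but not `v k`. Suppose `B` contains elements `x i`, "odd" elements
`δ i` and `ε` with `ε² = 0`, `ε` anticommuting with the `δ i` and commuting with the `x i`, and

  `⁅x i, x j⁆ = 2 (δ i) (δ j)`, `⁅δ i, x j⁆ = ε (δ i) (δ j)`, `(δ i) (δ j) = -(δ j) (δ i)`.

These relations propagate to the whole subring generated by the `x i` if one extends `x i ↦ δ i`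
by the deformed Leibniz rule `δ(a b) = a δb + (δa) b + ε (δa) (δb)` (`Compatible.mul`). Hence
`⁅⁅a, b⁆, c⁆ = -4 ε (δa) (δb) (δc)` for all `a, b, c` in the subring, and since `ε² = 0`
one more commutator gives zero (`Compatible.lie_lie_lie_eq_zero`). The Jacobi identity for
`x i, x j, x l` demands `12 ε (δ i) (δ j) (δ l) = 0`, which explains why characteristic `3` is needed.

In characteristic `3` the elements are found in a Clifford algebra with anticommuting generators
`e i`, `g i`, `ε` and elements `h i` dual to the `g i`: `x i = e i * u i` and `δ i = e i * w`, where
`w = 1 - ε θ`, `θ = ∑ g l` and `u i = θ - h i - ε q i`, the `q i` being quadratic expressions in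
the `g l`. The relations between the `x i` and `δ i` then reduce to `u i u j + u j u i = w²` for
`i ≠ j` (`Fermions.u_mul_u_add`) and `⁅w, u i⁆ = ε` (`Fermions.w_mul_u_sub`). The image of `v k`
is, up to sign, the product of `ε` with distinct generators `e i`, which is nonzero.
-/

namespace LieNilpotent

/-! ### Torsion in rings that are Lie nilpotent of class three -/

theorem three_mul_lie_mul_lie_lie {Q : Type*} [Ring Q]
    (hQ : ∀ a b c d : Q, ⁅⁅⁅a, b⁆, c⁆, d⁆ = 0) (a b c d e : Q) :
    3 * (⁅a, b⁆ * ⁅⁅c, d⁆, e⁆) = 0 := by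
  have central (a b c d : Q) : d * ⁅⁅a, b⁆, c⁆ = ⁅⁅a, b⁆, c⁆ * d :=
    (sub_eq_zero.mp (hQ a b c d)).symm
  have swap_left (a b c d e : Q) : ⁅a, b⁆ * ⁅⁅c, d⁆, e⁆ = -(⁅b, a⁆ * ⁅⁅c, d⁆, e⁆) := by
    simp only [Ring.lie_def]; noncomm_ring
  have swap_right (a b c d e : Q) : ⁅a, b⁆ * ⁅⁅c, d⁆, e⁆ = -(⁅a, b⁆ * ⁅⁅d, c⁆, e⁆) := by
    simp only [Ring.lie_def]; noncomm_ring
  have swap_mid (a b c d e : Q) : ⁅a, b⁆ * ⁅⁅c, d⁆, e⁆ = -(⁅a, e⁆ * ⁅⁅c, d⁆, b⁆) := by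
    have h := hQ c d (b * e) a
    have h1 : ⁅⁅c, d⁆, b * e⁆ = b * ⁅⁅c, d⁆, e⁆ + ⁅⁅c, d⁆, b⁆ * e := by
      simp only [Ring.lie_def]; noncomm_ring
    have h2 := central c d b a
    have h3 := central c d e a
    have h4 := central c d b ⁅a, e⁆
    rw [h1] at h
    generalize ⁅⁅c, d⁆, e⁆ = u at *
    generalize ⁅⁅c, d⁆, b⁆ = w at *
    simp only [Ring.lie_def] at *
    linear_combination (norm := noncomm_ring) - h - b * h3 - h2 * e + h4
  have cross (a b c d e : Q) : ⁅a, b⁆ * ⁅⁅c, d⁆, e⁆ = -(⁅c, b⁆ * ⁅⁅a, d⁆, e⁆) := by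
    -- Centrality of triple commutators turns `⁅⁅⁅a * c, b⁆, d⁆, e⁆ = 0` into a six-term relation;
    -- four of its terms cancel in pairs by `swap_mid`.
    have h : ⁅a, e⁆ * ⁅⁅c, b⁆, d⁆ + ⁅c, b⁆ * ⁅⁅a, d⁆, e⁆ + ⁅a, d⁆ * ⁅⁅c, b⁆, e⁆
       + ⁅c, d⁆ * ⁅⁅a, b⁆, e⁆ + ⁅a, b⁆ * ⁅⁅c, d⁆, e⁆ + ⁅c, e⁆ * ⁅⁅a, b⁆, d⁆ = 0 := by
      have h0 := hQ (a * c) b d e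
      have h1 : ⁅⁅a * c, b⁆, d⁆ = a * ⁅⁅c, b⁆, d⁆ + ⁅a, d⁆ * ⁅c, b⁆ + ⁅a, b⁆ * ⁅c, d⁆
          + ⁅⁅a, b⁆, d⁆ * c := by
        simp only [Ring.lie_def]; noncomm_ring
      rw [h1, Ring.lie_def] at h0
      have e1 := hQ a d e ⁅c, b⁆
      have e2 := hQ a b d ⁅c, e⁆
      have e3 := hQ a b e ⁅c, d⁆
      have e4 := hQ c b d e
      have e5 := hQ a b d e
      rw [Ring.lie_def] at e1 e2 e3 e4 e5
      simp only [Ring.lie_def] at *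
      linear_combination (norm := noncomm_ring) h0 - e1 - e2 - e3 - a * e4 - e5 * c
    have h2 := swap_mid a e c b d
    have h3 := swap_mid c d a b e
    rw [h2, h3] at h
    rw [eq_neg_iff_add_eq_zero, ← h]
    abel
  have cycle (a b c d e : Q) : ⁅a, b⁆ * ⁅⁅d, e⁆, c⁆ = ⁅a, b⁆ * ⁅⁅c, d⁆, e⁆ := by
    rw [swap_mid a b d e c, swap_right a c d e b, swap_left a c e d b, cross c a e d b,
      swap_left e a c d b, swap_mid a e c d b]
    simp only [neg_neg]
  have jacobi : ⁅a, b⁆ * ⁅⁅c, d⁆, e⁆ + ⁅a, b⁆ * ⁅⁅d, e⁆, c⁆ + ⁅a, b⁆ * ⁅⁅e, c⁆, d⁆ = 0 := by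
    simp only [Ring.lie_def]; noncomm_ring
  rw [cycle a b d e c, cycle a b c d e] at jacobi
  rw [← jacobi]
  noncomm_ring

/-! ### Deformed differentials -/

/-- The relations between two elements `a`, `c` of a ring and their "differentials" `δ`, `κ`:
`⁅a, c⁆ = 2 δ κ`, `⁅δ, c⁆ = ε δ κ`, `⁅κ, a⁆ = ε κ δ`, and `δ`, `κ` anticommute. -/
structure Compatible {B : Type*} [Ring B] (ε a δ c κ : B) : Prop where
  comm : a * c = c * a + 2 * (δ * κ)
  comm_left : δ * c = c * δ + ε * δ * κ
  comm_right : κ * a = a * κ + ε * κ * δ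
  anti : δ * κ = -(κ * δ)

namespace Compatible

variable {B : Type*} [Ring B] {ε : B}

theorem symm {a δ c κ : B} (h : Compatible ε a δ c κ) : Compatible ε c κ a δ where
  comm := by linear_combination (norm := noncomm_ring) -h.comm - 2 * h.anti
  comm_left := h.comm_right
  comm_right := h.comm_left
  anti := by rw [h.anti, neg_neg]

/-- Compatibility with a fixed `(c, κ)` is preserved by products, for the deformed Leibniz rule
`δ(a b) = a δb + (δa) b + ε (δa) (δb)`. -/
theorem mul {a δ b γ c κ : B} (hsq : ε * ε = 0)
    (ea : ε * a = a * ε) (eδ : ε * δ = -(δ * ε)) (ec : ε * c = c * ε) (eκ : ε * κ = -(κ * ε))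
    (h : Compatible ε a δ c κ) (h' : Compatible ε b γ c κ) :
    Compatible ε (a * b) (a * γ + δ * b + ε * δ * γ) c κ := by
  have hz : ε * δ * ε = 0 := by linear_combination (norm := noncomm_ring) eδ * ε - δ * hsq
  have hz' : ε * κ * ε = 0 := by linear_combination (norm := noncomm_ring) eκ * ε - κ * hsq
  refine ⟨?_, ?_, ?_, ?_⟩
  · linear_combination (norm := noncomm_ring) a * h'.comm + h.comm * b + 2 * δ * h'.comm_right
      + 2 * eδ * κ * γ - 2 * ε * δ * h'.anti
  · linear_combination (norm := noncomm_ring) a * h'.comm_left + h.comm * γ + δ * h'.comm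
      + h.comm_left * b + ε * δ * h'.comm_left + ε * h.comm_left * γ + ec * δ * γ - ea * γ * κ
      + ε * δ * h'.comm_right + 2 * δ * h'.anti + hz * γ * κ + hz * κ * γ + hsq * δ * κ * γ
      - hsq * δ * γ * κ
  · linear_combination (norm := noncomm_ring) h.comm_right * b + a * h'.comm_right - ea * κ * γ
      - ε * h.comm_right * γ - hsq * κ * δ * γ - hz' * δ * γ
  · linear_combination (norm := noncomm_ring) a * h'.anti + h.comm_right * γ + h.anti * b
      - δ * h'.comm_right + eκ * δ * γ + ε * δ * h'.anti - eδ * κ * γ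

theorem lie_eq {a δa b δb : B} (hab : Compatible ε a δa b δb) : ⁅a, b⁆ = 2 * (δa * δb) := by
  rw [Ring.lie_def, hab.comm, add_sub_cancel_left]

theorem lie_lie_eq {a δa b δb c δc : B} (ea : ε * δa = -(δa * ε)) (hab : Compatible ε a δa b δb)
    (hac : Compatible ε a δa c δc) (hbc : Compatible ε b δb c δc) :
    ⁅⁅a, b⁆, c⁆ = -4 * (ε * δa * δb * δc) := by
  rw [hab.lie_eq, Ring.lie_def]
  linear_combination (norm := noncomm_ring) 2 * δa * hbc.comm_left + 2 * hac.comm_left * δb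
    + 2 * ea * δb * δc + 2 * ε * δa * hbc.anti

/-- The commutator of `ε (δa) (δb) (δc)` with `d` is a sum of products containing `ε` twice. -/
theorem lie_lie_lie_eq_zero {a δa b δb c δc d δd : B} (hsq : ε * ε = 0)
    (ed : ε * d = d * ε) (ea : ε * δa = -(δa * ε)) (eb : ε * δb = -(δb * ε))
    (hab : Compatible ε a δa b δb) (hac : Compatible ε a δa c δc) (hbc : Compatible ε b δb c δc)
    (had : Compatible ε a δa d δd) (hbd : Compatible ε b δb d δd) (hcd : Compatible ε c δc d δd) :
    ⁅⁅⁅a, b⁆, c⁆, d⁆ = 0 := by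
  rw [lie_lie_eq ea hab hac hbc, Ring.lie_def]
  have ha : ε * δa * ε = 0 := by linear_combination (norm := noncomm_ring) ea * ε - δa * hsq
  have hb : ε * δa * δb * ε = 0 := by
    linear_combination (norm := noncomm_ring) ε * δa * eb - ha * δb
  linear_combination (norm := noncomm_ring) -4 * ε * δa * δb * hcd.comm_left
    - 4 * ε * δa * hbd.comm_left * δc - 4 * ε * had.comm_left * δb * δc - 4 * ed * δa * δb * δc
    - 4 * hb * δc * δd - 4 * ha * δb * δd * δc - 4 * hsq * δa * δd * δb * δc

end Compatible

/-- The pairs `(a, δa)` obtained from the pairs `(x i, δ i)` and the pairs `(m, 0)`, `m` an integer,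
by addition and the deformed Leibniz rule. As a relation it avoids showing that `δa` is determined
by `a`; only the existence of some `δa` for each `a` is used. -/
inductive DifferentialPair {B I : Type*} [Ring B] (ε : B) (x δ : I → B) : B → B → Prop
  | const (m : ℤ) : DifferentialPair ε x δ m 0
  | gen (i : I) : DifferentialPair ε x δ (x i) (δ i)
  | add {a α b β : B} : DifferentialPair ε x δ a α → DifferentialPair ε x δ b β →
      DifferentialPair ε x δ (a + b) (α + β)
  | mul {a α b β : B} : DifferentialPair ε x δ a α → DifferentialPair ε x δ b β →
      DifferentialPair ε x δ (a * b) (a * β + α * b + ε * α * β)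

namespace DifferentialPair

variable {B I : Type*} [Ring B] {ε : B} {x δ : I → B}

theorem eps_comm (hsq : ε * ε = 0) (hx : ∀ i, ε * x i = x i * ε) (hδ : ∀ i, ε * δ i = -(δ i * ε))
    {a α : B} (h : DifferentialPair ε x δ a α) : ε * a = a * ε ∧ ε * α = -(α * ε) := by
  induction h with
  | const m => exact ⟨(Int.commute_cast ε m).eq, by simp⟩
  | gen i => exact ⟨hx i, hδ i⟩
  | add _ _ iha ihb =>
    exact ⟨by rw [mul_add, add_mul, iha.1, ihb.1], by rw [mul_add, add_mul, iha.2, ihb.2]; abel⟩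
  | @mul a α b β _ _ iha ihb =>
    obtain ⟨ea, eα⟩ := iha
    obtain ⟨eb, eβ⟩ := ihb
    constructor
    · linear_combination (norm := noncomm_ring) ea * b + a * eb
    · have hz : ε * α * β * ε = 0 := by
        linear_combination (norm := noncomm_ring) ε * α * eβ - eα * ε * β + α * hsq * β
      linear_combination (norm := noncomm_ring) ea * β + a * eβ + eα * b - α * eb
        + hsq * α * β + hz

theorem compat (hsq : ε * ε = 0) (hx : ∀ i, ε * x i = x i * ε) (hδ : ∀ i, ε * δ i = -(δ i * ε))
    {c κ : B} (hc : ε * c = c * ε) (hκ : ε * κ = -(κ * ε)) (hgen : ∀ i, Compatible ε (x i) (δ i) c κ)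
    {a α : B} (h : DifferentialPair ε x δ a α) : Compatible ε a α c κ := by
  induction h with
  | const m => exact ⟨by simp [(Int.commute_cast c m).eq], by simp,
      by simp [(Int.commute_cast κ m).eq], by simp⟩
  | gen i => exact hgen i
  | add _ _ iha ihb =>
    refine ⟨?_, ?_, ?_, ?_⟩
    · linear_combination (norm := noncomm_ring) iha.comm + ihb.comm
    · linear_combination (norm := noncomm_ring) iha.comm_left + ihb.comm_left
    · linear_combination (norm := noncomm_ring) iha.comm_right + ihb.comm_right
    · linear_combination (norm := noncomm_ring) iha.anti + ihb.anti
  | mul ha _ iha ihb =>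
    have := ha.eps_comm hsq hx hδ
    exact iha.mul hsq this.1 this.2 hc hκ ihb

/-- Compatibility of the generators extends first to one argument, then by symmetry to both. -/
theorem compat_of_gen (hsq : ε * ε = 0) (hx : ∀ i, ε * x i = x i * ε)
    (hδ : ∀ i, ε * δ i = -(δ i * ε)) (hgen : ∀ i j, Compatible ε (x i) (δ i) (x j) (δ j))
    {a α b β : B} (ha : DifferentialPair ε x δ a α) (hb : DifferentialPair ε x δ b β) :
    Compatible ε a α b β :=
  have hb' := hb.eps_comm hsq hx hδ
  ha.compat hsq hx hδ hb'.1 hb'.2 fun i =>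
    (hb.compat hsq hx hδ (hx i) (hδ i) fun j => hgen j i).symm

theorem exists_lift (f : FreeAlgebra ℤ I) :
    ∃ α, DifferentialPair ε x δ (FreeAlgebra.lift ℤ x f) α := by
  induction f using FreeAlgebra.induction with
  | grade0 r => exact ⟨0, by simpa using const r⟩
  | grade1 i => exact ⟨δ i, by simpa using gen i⟩
  | mul a b ha hb =>
    obtain ⟨α, hα⟩ := ha
    obtain ⟨β, hβ⟩ := hb
    exact ⟨_, by simpa using hα.mul hβ⟩
  | add a b ha hb =>
    obtain ⟨α, hα⟩ := ha
    obtain ⟨β, hβ⟩ := hb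
    exact ⟨_, by simpa using hα.add hβ⟩

/-- The homomorphism `X i ↦ x i` from the free ring kills all fourfold commutators. -/
theorem lift_lie_lie_lie (hsq : ε * ε = 0) (hx : ∀ i, ε * x i = x i * ε)
    (hδ : ∀ i, ε * δ i = -(δ i * ε)) (hgen : ∀ i j, Compatible ε (x i) (δ i) (x j) (δ j))
    (a b c d : FreeAlgebra ℤ I) : FreeAlgebra.lift ℤ x ⁅⁅⁅a, b⁆, c⁆, d⁆ = 0 := by
  obtain ⟨α, ha⟩ := exists_lift (x := x) (δ := δ) (ε := ε) a
  obtain ⟨β, hb⟩ := exists_lift (x := x) (δ := δ) (ε := ε) b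
  obtain ⟨γ, hc⟩ := exists_lift (x := x) (δ := δ) (ε := ε) c
  obtain ⟨κ, hd⟩ := exists_lift (x := x) (δ := δ) (ε := ε) d
  have key := Compatible.lie_lie_lie_eq_zero hsq (hd.eps_comm hsq hx hδ).1
    (ha.eps_comm hsq hx hδ).2 (hb.eps_comm hsq hx hδ).2
    (ha.compat_of_gen hsq hx hδ hgen hb) (ha.compat_of_gen hsq hx hδ hgen hc)
    (hb.compat_of_gen hsq hx hδ hgen hc) (ha.compat_of_gen hsq hx hδ hgen hd)
    (hb.compat_of_gen hsq hx hδ hgen hd) (hc.compat_of_gen hsq hx hδ hgen hd)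
  simpa only [Ring.lie_def, map_sub, map_mul] using key

end DifferentialPair

/-! ### Fermions in a Clifford algebra of characteristic three -/

/-- Creation and annihilation operators: two families of elements of a ring satisfying the canonical
anticommutation relations. The relations `(cr i)² = 0` and `(an i)² = 0` are not imposed; they follow
when `2` is invertible. -/
structure Fermions (B ι : Type*) [Ring B] [DecidableEq ι] where
  cr : ι → B
  an : ι → B
  cr_cr (i j : ι) : cr i * cr j = -(cr j * cr i)
  an_an (i j : ι) : an i * an j = -(an j * an i)
  an_cr (i j : ι) : an i * cr j = (if i = j then 1 else 0) - cr j * an i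

/-- The canonical anticommutation relations hold in the Clifford algebra of the hyperbolic quadratic
form on `V* × V`, for `V` free over `ZMod 3`. -/
noncomputable def cliffordFermions (ι : Type*) [DecidableEq ι] :
    Fermions (CliffordAlgebra (QuadraticForm.dualProd (ZMod 3) (ι →₀ ZMod 3))) ι where
  cr i := CliffordAlgebra.ι _ (0, Finsupp.single i 1)
  an i := CliffordAlgebra.ι _ (Finsupp.lapply i, 0)
  cr_cr i j := by
    rw [eq_neg_iff_add_eq_zero, CliffordAlgebra.ι_mul_ι_add_swap]
    simp [QuadraticMap.polar]
  an_an i j := by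
    rw [eq_neg_iff_add_eq_zero, CliffordAlgebra.ι_mul_ι_add_swap]
    simp [QuadraticMap.polar]
  an_cr i j := by
    rw [eq_sub_iff_add_eq, CliffordAlgebra.ι_mul_ι_add_swap]
    simp [QuadraticMap.polar, Finsupp.single_apply, eq_comm]

theorem nontrivial_clifford (ι : Type*) :
    Nontrivial (CliffordAlgebra (QuadraticForm.dualProd (ZMod 3) (ι →₀ ZMod 3))) := by
  have : Invertible (2 : ZMod 3) := ⟨2, by decide, by decide⟩
  infer_instance

theorem three_eq_zero_clifford (ι : Type*) :
    (3 : CliffordAlgebra (QuadraticForm.dualProd (ZMod 3) (ι →₀ ZMod 3))) = 0 := by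
  have h := map_ofNat (algebraMap (ZMod 3)
    (CliffordAlgebra (QuadraticForm.dualProd (ZMod 3) (ι →₀ ZMod 3)))) 3
  exact h.symm.trans (map_zero _)

/-- Indices for the fermions: one for `ε`, and two sequences for the `e i` and the `g i`. -/
abbrev Idx : Type := Option (ℕ ⊕ ℕ)

theorem eq_zero_of_eq_neg {B : Type*} [Ring B] {a : B} (h3 : (3 : B) = 0) (h : a = -a) : a = 0 := by
  linear_combination (norm := noncomm_ring) a * h3 - h

namespace Fermions

variable {B : Type*} [Ring B] (F : Fermions B Idx)

/-- The creation operator used as deformation parameter. -/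
def ε : B := F.cr none

/-- The first sequence of creation operators. -/
def e (i : ℕ) : B := F.cr (some (.inl i))

/-- The second sequence of creation operators. -/
def g (i : ℕ) : B := F.cr (some (.inr i))

/-- The annihilation operator dual to `g i`. -/
def h (i : ℕ) : B := F.an (some (.inr i))

/-- The sum of the first `n` of the `g l`. -/
def θ (n : ℕ) : B := ∑ l ∈ Finset.range n, F.g l

/-- Quadratic expressions `q i = ∑ b(i, k, l) (g k) (g l)` with `b(i, k, l) ∈ {0, 1}`. With
`c(i, j, l) = b(i, j, l) - b(i, l, j)`, the coefficients are chosen so that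
`c(i, j, l) + c(j, i, l) = -1` modulo `3` for all `l` and all `i ≠ j`; see `h_q_add`. No choice
symmetric under all permutations of the indices exists, so `b` depends on their order. -/
def q (n i : ℕ) : B := ∑ k ∈ Finset.range n, ∑ l ∈ Finset.range n,
  if (l < i ∧ l < k) ∨ (k = i ∧ i < l) then F.g k * F.g l else 0

/-- Odd elements with `u i * u j + u j * u i` independent of `i ≠ j`; see `u_mul_u_add`. -/
def u (n i : ℕ) : B := F.θ n - F.h i - F.ε * F.q n i

/-- The common factor of the differentials of the generators. -/
def w (n : ℕ) : B := 1 - F.ε * F.θ n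

theorem cr_mul_self (h3 : (3 : B) = 0) (i : Idx) : F.cr i * F.cr i = 0 :=
  eq_zero_of_eq_neg h3 (F.cr_cr i i)

theorem h_g (i j : ℕ) : F.h i * F.g j = (if i = j then 1 else 0) - F.g j * F.h i := by
  simp [h, g, F.an_cr]

theorem h_cr_of_ne {i : ℕ} {j : Idx} (hj : some (.inr i) ≠ j) :
    F.h i * F.cr j = -(F.cr j * F.h i) := by
  simp [h, F.an_cr, hj]

theorem cr_θ (j : Idx) (n : ℕ) : F.cr j * F.θ n = -(F.θ n * F.cr j) := by
  simp only [θ, Finset.mul_sum, Finset.sum_mul, ← Finset.sum_neg_distrib]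
  exact Finset.sum_congr rfl fun l _ => F.cr_cr _ _

theorem h_θ {i n : ℕ} (hi : i < n) : F.h i * F.θ n = 1 - F.θ n * F.h i := by
  simp [θ, Finset.mul_sum, Finset.sum_mul, h_g, Finset.sum_sub_distrib, hi]

theorem θ_θ (h3 : (3 : B) = 0) (n : ℕ) : F.θ n * F.θ n = 0 := by
  refine eq_zero_of_eq_neg h3 ?_
  nth_rw 1 4 [θ]
  simp only [Finset.mul_sum, Finset.sum_mul, ← Finset.sum_neg_distrib]
  exact Finset.sum_congr rfl fun l _ => F.cr_θ _ n

theorem commute_q {z : B} (hz : ∀ k, z * F.g k = -(F.g k * z)) (n i : ℕ) :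
    z * F.q n i = F.q n i * z := by
  simp only [q, Finset.mul_sum, Finset.sum_mul]
  refine Finset.sum_congr rfl fun k _ => Finset.sum_congr rfl fun l _ => ?_
  split_ifs
  · linear_combination (norm := noncomm_ring) hz k * F.g l - F.g k * hz l
  · simp

theorem h_q {i j n : ℕ} (hj : j < n) : F.h j * F.q n i - F.q n i * F.h j =
    ∑ l ∈ Finset.range n, ((if (l < i ∧ l < j) ∨ (j = i ∧ i < l) then F.g l else 0) -
      if (j < i ∧ j < l) ∨ (l = i ∧ i < j) then F.g l else 0) := by
  have key (k l : ℕ) : F.h j * (F.g k * F.g l) - F.g k * F.g l * F.h j =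
      (if j = k then F.g l else 0) - (if j = l then F.g k else 0) := by
    have h1 := F.h_g j k
    have h2 := F.h_g j l
    split_ifs at * <;> linear_combination (norm := noncomm_ring) h1 * F.g l - F.g k * h2
  have step (k l : ℕ) (p : Prop) [Decidable p] :
      F.h j * (if p then F.g k * F.g l else 0) - (if p then F.g k * F.g l else 0) * F.h j =
      (if j = k then (if p then F.g l else 0) else 0) -
        (if j = l then (if p then F.g k else 0) else 0) := by
    by_cases hp : p
    · simpa [hp] using key k l
    · simp [hp]
  simp only [q, Finset.mul_sum, Finset.sum_mul, ← Finset.sum_sub_distrib, step]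
  simp only [Finset.sum_sub_distrib]
  congr 1
  · rw [Finset.sum_comm]
    simp [hj]
  · simp [hj]

/-- The property of the coefficients of `q` on which the choice of `q` rests. -/
theorem h_q_add {i j n : ℕ} (h3 : (3 : B) = 0) (hi : i < n) (hj : j < n) (hij : i ≠ j) :
    F.h j * F.q n i - F.q n i * F.h j + (F.h i * F.q n j - F.q n j * F.h i) = - F.θ n := by
  rw [h_q F hj, h_q F hi, ← Finset.sum_add_distrib, θ, ← Finset.sum_neg_distrib]
  refine Finset.sum_congr rfl fun l _ => ?_
  have h2 : F.g l + F.g l = -F.g l := by linear_combination (norm := noncomm_ring) h3 * F.g l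
  -- In each possible order of `i`, `j`, `l` the coefficients of `g l` add up to `2` or to `-1`.
  split_ifs <;> first | omega | simp [h2]

theorem ε_ε (h3 : (3 : B) = 0) : F.ε * F.ε = 0 := F.cr_mul_self h3 _

/-- The right-hand side is `w n * w n`, see `w_w`. -/
theorem u_mul_u_add {i j n : ℕ} (h3 : (3 : B) = 0) (hi : i < n) (hj : j < n) (hij : i ≠ j) :
    F.u n i * F.u n j + F.u n j * F.u n i = 1 + F.ε * F.θ n := by
  have hone : (1 : B) + 1 + 1 = 0 := by rw [← h3]; norm_num
  have tt := F.θ_θ h3 n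
  have Hi := F.h_θ hi
  have Hj := F.h_θ hj
  have hh : F.h i * F.h j = -(F.h j * F.h i) := F.an_an _ _
  have et : F.ε * F.θ n = -(F.θ n * F.ε) := F.cr_θ _ n
  have tq (i) : F.θ n * F.q n i = F.q n i * F.θ n :=
    F.commute_q (fun k => (by rw [g, cr_θ, neg_neg])) n i
  have eq (i) : F.ε * F.q n i = F.q n i * F.ε := F.commute_q (fun k => F.cr_cr _ _) n i
  have he (i) : F.h i * F.ε = -(F.ε * F.h i) := F.h_cr_of_ne (by simp)
  have ee := F.ε_ε h3
  have R := F.h_q_add h3 hi hj hij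
  have tqi := tq i
  have tqj := tq j
  have eqi := eq i
  have eqj := eq j
  have hei := he i
  have hej := he j
  simp only [u]
  generalize F.θ n = t at *
  generalize F.q n i = qi at *
  generalize F.q n j = qj at *
  generalize F.h i = hi' at *
  generalize F.h j = hj' at *
  generalize F.ε = ε at *
  linear_combination (norm := noncomm_ring) 2 * tt - Hi - Hj + hh - et * qi - et * qj + ε * tqi
    + ε * tqj + hei * qj + hej * qi - ε * R - ε * eqi * qj + ee * qi * qj - ε * eqj * qi
    + ee * qj * qi - hone

theorem u_e (i j n : ℕ) : F.u n i * F.e j = -(F.e j * F.u n i) := by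
  have h1 : F.e j * F.θ n = -(F.θ n * F.e j) := F.cr_θ _ n
  have h2 : F.h i * F.e j = -(F.e j * F.h i) := F.h_cr_of_ne (by simp)
  have h3 : F.e j * F.q n i = F.q n i * F.e j := F.commute_q (fun k => F.cr_cr _ _) n i
  have h4 : F.ε * F.e j = -(F.e j * F.ε) := F.cr_cr _ _
  simp only [u]
  linear_combination (norm := noncomm_ring) h1 - h2 + F.ε * h3 - h4 * F.q n i

theorem ε_u (h3 : (3 : B) = 0) (i n : ℕ) : F.ε * F.u n i = -(F.u n i * F.ε) := by
  have h1 : F.ε * F.θ n = -(F.θ n * F.ε) := F.cr_θ _ n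
  have h2 : F.h i * F.ε = -(F.ε * F.h i) := F.h_cr_of_ne (by simp)
  have h3' : F.ε * F.q n i = F.q n i * F.ε := F.commute_q (fun k => F.cr_cr _ _) n i
  have ee := F.ε_ε h3
  simp only [u]
  linear_combination (norm := noncomm_ring) h1 - h2 + F.ε * h3' - 2 * ee * F.q n i

theorem w_e (j n : ℕ) : F.w n * F.e j = F.e j * F.w n := by
  have h1 : F.e j * F.θ n = -(F.θ n * F.e j) := F.cr_θ _ n
  have h4 : F.ε * F.e j = -(F.e j * F.ε) := F.cr_cr _ _
  simp only [w]
  linear_combination (norm := noncomm_ring) h4 * F.θ n - F.ε * h1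

theorem ε_w (h3 : (3 : B) = 0) (n : ℕ) : F.ε * F.w n = F.ε := by
  have ee := F.ε_ε h3
  simp only [w]
  linear_combination (norm := noncomm_ring) - ee * F.θ n

theorem w_ε (h3 : (3 : B) = 0) (n : ℕ) : F.w n * F.ε = F.ε := by
  have ee := F.ε_ε h3
  have h1 : F.ε * F.θ n = -(F.θ n * F.ε) := F.cr_θ _ n
  simp only [w]
  linear_combination (norm := noncomm_ring) -h1 * F.ε + F.θ n * ee

theorem w_w (h3 : (3 : B) = 0) (n : ℕ) : F.w n * F.w n = 1 + F.ε * F.θ n := by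
  have ee := F.ε_ε h3
  have h1 : F.ε * F.θ n = -(F.θ n * F.ε) := F.cr_θ _ n
  simp only [w]
  linear_combination (norm := noncomm_ring) F.ε * F.θ n * h1 - h3 * F.ε * F.θ n
    - F.ε * F.θ_θ h3 n * F.ε

theorem w_mul_u_sub {i n : ℕ} (h3 : (3 : B) = 0) (hi : i < n) :
    F.w n * F.u n i - F.u n i * F.w n = F.ε := by
  have ht := F.h_θ hi
  have h1 : F.θ n * F.u n i + F.u n i * F.θ n = -1 := by
    have tt := F.θ_θ h3 n
    have tq : F.θ n * F.q n i = F.q n i * F.θ n :=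
      F.commute_q (fun k => (by rw [g, cr_θ, neg_neg])) n i
    have et : F.ε * F.θ n = -(F.θ n * F.ε) := F.cr_θ _ n
    simp only [u]
    linear_combination (norm := noncomm_ring) 2 * tt - ht - et * F.q n i + F.ε * tq
  have h2 := F.ε_u h3 i n
  simp only [w]
  linear_combination (norm := noncomm_ring) -F.ε * h1 + h2 * F.θ n

/-- The image of the `i`-th generator of the free ring, nonzero only for `i < n`. -/
def x (n i : ℕ) : B := if i < n then F.e i * F.u n i else 0

/-- The differential of `F.x n i`. -/
def dx (n i : ℕ) : B := if i < n then F.e i * F.w n else 0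

theorem ε_x (h3 : (3 : B) = 0) (n i : ℕ) : F.ε * F.x n i = F.x n i * F.ε := by
  unfold x
  split_ifs
  · have h4 : F.ε * F.e i = -(F.e i * F.ε) := F.cr_cr _ _
    linear_combination (norm := noncomm_ring) h4 * F.u n i - F.e i * F.ε_u h3 i n
  · simp

theorem ε_dx (h3 : (3 : B) = 0) (n i : ℕ) : F.ε * F.dx n i = -(F.dx n i * F.ε) := by
  unfold dx
  split_ifs
  · have h4 : F.ε * F.e i = -(F.e i * F.ε) := F.cr_cr _ _
    linear_combination (norm := noncomm_ring) h4 * F.w n - F.e i * F.ε_w h3 n + F.e i * F.w_ε h3 n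
  · simp

theorem compat_x (h3 : (3 : B) = 0) (n i j : ℕ) :
    Compatible F.ε (F.x n i) (F.dx n i) (F.x n j) (F.dx n j) := by
  by_cases hi : i < n
  swap
  · constructor <;> simp [x, dx, hi]
  by_cases hj : j < n
  swap
  · constructor <;> simp [x, dx, hj]
  simp only [x, dx, if_pos hi, if_pos hj]
  have hl {i j : ℕ} (hj : j < n) : F.e i * F.w n * (F.e j * F.u n j) =
      F.e j * F.u n j * (F.e i * F.w n) + F.ε * (F.e i * F.w n) * (F.e j * F.w n) := by
    have ee : F.e i * F.e j = -(F.e j * F.e i) := F.cr_cr _ _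
    have h4 : F.ε * F.e i = -(F.e i * F.ε) := F.cr_cr _ _
    have h5 : F.ε * F.e j = -(F.e j * F.ε) := F.cr_cr _ _
    linear_combination (norm := noncomm_ring) F.e i * F.w_e j n * F.u n j
      - F.e j * F.u_e j i n * F.w n + ee * F.u n j * F.w n + F.e i * F.e j * F.w_mul_u_sub h3 hj
      - F.ε * F.e i * F.w_e j n * F.w n - h4 * F.e j * F.w n * F.w n + F.e i * h5 * F.w n * F.w n
      - F.e i * F.e j * F.ε_w h3 n * F.w n - F.e i * F.e j * F.ε_w h3 n
  have ha : F.e i * F.w n * (F.e j * F.w n) = -(F.e j * F.w n * (F.e i * F.w n)) := by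
    have ee : F.e i * F.e j = -(F.e j * F.e i) := F.cr_cr _ _
    linear_combination (norm := noncomm_ring) F.e i * F.w_e j n * F.w n + F.e j * F.w_e i n * F.w n
      + ee * F.w n * F.w n
  refine ⟨?_, hl hj, hl hi, ha⟩
  obtain rfl | hij := eq_or_ne i j
  · rw [eq_zero_of_eq_neg h3 ha]
    simp
  · have ee : F.e i * F.e j = -(F.e j * F.e i) := F.cr_cr _ _
    linear_combination (norm := noncomm_ring) F.e i * F.u_e i j n * F.u n j
      - F.e j * F.u_e j i n * F.u n i + ee * F.u n j * F.u n i
      - F.e i * F.e j * F.u_mul_u_add h3 hi hj hij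
      - 2 * F.e i * F.w_e j n * F.w n - 2 * F.e i * F.e j * F.w_w h3 n
      - h3 * F.e i * F.e j * (1 + F.ε * F.θ n)

/-- The ordered product `e 0 * e 1 * ⋯ * e (m - 1)`. -/
def eProd (m : ℕ) : B := ((List.range m).map F.e).prod

theorem eProd_succ (m : ℕ) : F.eProd (m + 1) = F.eProd m * F.e m := by
  simp [eProd, List.range_succ]

/-- Each `e m` can be stripped off by taking the supercommutator with its dual, leaving `ε ≠ 0`. -/
theorem eProd_mul_ε_ne_zero [Nontrivial B] (m : ℕ) : F.eProd m * F.ε ≠ 0 := by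
  induction m with
  | zero =>
    intro h0
    have h0 : F.ε = 0 := by simpa [eProd] using h0
    have h1 := F.an_cr none none
    change _ * F.ε = _ - F.ε * _ at h1
    simp [h0] at h1
  | succ m ih =>
    intro h0
    apply ih
    have hsign (k : ℕ) (hk : k ≤ m) : F.an (some (.inl m)) * F.eProd k =
        (-1) ^ k * (F.eProd k * F.an (some (.inl m))) := by
      induction k with
      | zero => simp [eProd]
      | succ k ihk =>
        have h1 : F.an (some (.inl m)) * F.e k = -(F.e k * F.an (some (.inl m))) := by
          simp [e, F.an_cr, show m ≠ k by omega]
        rw [eProd_succ, ← mul_assoc, ihk (by omega), mul_assoc, mul_assoc, h1]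
        simp [pow_succ, mul_assoc]
    have h1 : F.an (some (.inl m)) * F.e m = 1 - F.e m * F.an (some (.inl m)) := by
      simp [e, F.an_cr]
    have h2 : F.an (some (.inl m)) * F.ε = -(F.ε * F.an (some (.inl m))) := by
      simp [ε, F.an_cr]
    have h3 : F.an (some (.inl m)) * (F.eProd (m + 1) * F.ε) = 0 := by rw [h0, mul_zero]
    have h4 : F.an (some (.inl m)) * (F.eProd (m + 1) * F.ε) =
        (-1) ^ m * (F.eProd m * F.ε) + (-1) ^ m * (F.eProd (m + 1) * F.ε * F.an (some (.inl m))) := by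
      rw [eProd_succ]
      linear_combination (norm := noncomm_ring) hsign m le_rfl * F.e m * F.ε
        + (-1) ^ m * F.eProd m * h1 * F.ε - (-1) ^ m * F.eProd m * F.e m * h2
    rw [h3, h0, zero_mul, mul_zero, add_zero] at h4
    rcases neg_one_pow_eq_or B m with hs | hs <;> simpa [hs] using h4.symm

/-- If `w` fixes `y`, each factor `⁅x (2 i), x (2 i + 1)⁆ = 2 (e (2 i)) w (e (2 i + 1)) w` may be replaced
by `-e (2 i) * e (2 i + 1)`, because `w` commutes with the `e j` and `2 = -1`. -/
theorem prod_lie_mul (h3 : (3 : B) = 0) {n m : ℕ} (hm : 2 * m ≤ n) {y : B}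
    (hy : F.w n * y = y) :
    ((List.range m).map fun i => ⁅F.x n (2 * i), F.x n (2 * i + 1)⁆).prod * y =
      (-1) ^ m * (F.eProd (2 * m) * y) := by
  induction m generalizing y with
  | zero => simp [eProd]
  | succ m ih =>
    have h1 : ⁅F.x n (2 * m), F.x n (2 * m + 1)⁆ * y =
        -(F.e (2 * m) * F.e (2 * m + 1) * y) := by
      rw [(F.compat_x h3 n _ _).lie_eq, dx, dx, if_pos (by omega), if_pos (by omega)]
      linear_combination (norm := noncomm_ring) 2 * F.e (2 * m) * F.w_e (2 * m + 1) n * F.w n * y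
        + 2 * F.e (2 * m) * F.e (2 * m + 1) * F.w n * hy + 2 * F.e (2 * m) * F.e (2 * m + 1) * hy
        + h3 * F.e (2 * m) * F.e (2 * m + 1) * y
    have h2 : F.w n * (F.e (2 * m) * F.e (2 * m + 1) * y) = F.e (2 * m) * F.e (2 * m + 1) * y := by
      linear_combination (norm := noncomm_ring) F.w_e (2 * m) n * F.e (2 * m + 1) * y
        + F.e (2 * m) * F.w_e (2 * m + 1) n * y + F.e (2 * m) * F.e (2 * m + 1) * hy
    rw [List.range_succ, List.map_append, List.prod_append, mul_assoc]
    simp only [List.map_cons, List.map_nil, List.prod_cons, List.prod_nil, mul_one]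
    rw [h1, mul_neg, ih (by omega) h2, show 2 * (m + 1) = 2 * m + 1 + 1 by ring, eProd_succ,
      eProd_succ, pow_succ']
    simp only [mul_assoc, neg_mul, one_mul]

theorem lie_lie_x (h3 : (3 : B) = 0) {n m : ℕ} (hm : m + 2 < n) :
    ⁅⁅F.x n m, F.x n (m + 1)⁆, F.x n (m + 2)⁆ = F.e m * F.e (m + 1) * F.e (m + 2) * F.ε := by
  rw [Compatible.lie_lie_eq (F.ε_dx h3 n m) (F.compat_x h3 n _ _) (F.compat_x h3 n _ _)
    (F.compat_x h3 n _ _), dx, dx, dx, if_pos (by omega), if_pos (by omega), if_pos hm]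
  have ew (i : ℕ) : F.ε * (F.e i * F.w n) = -(F.e i * F.ε) := by
    have h4 : F.ε * F.e i = -(F.e i * F.ε) := F.cr_cr _ _
    linear_combination (norm := noncomm_ring) h4 * F.w n - F.e i * F.ε_w h3 n
  linear_combination (norm := noncomm_ring) -4 * ew m * (F.e (m + 1) * F.w n) *
      (F.e (m + 2) * F.w n) + 4 * F.e m * ew (m + 1) * (F.e (m + 2) * F.w n)
    - 4 * F.e m * F.e (m + 1) * ew (m + 2) + h3 * F.e m * F.e (m + 1) * F.e (m + 2) * F.ε

theorem prod_lie_mul_lie_lie_ne_zero [Nontrivial B] (h3 : (3 : B) = 0) (k : ℕ) :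
    ((List.range k).map fun i => ⁅F.x (2 * k + 3) (2 * i), F.x (2 * k + 3) (2 * i + 1)⁆).prod *
      ⁅⁅F.x (2 * k + 3) (2 * k), F.x (2 * k + 3) (2 * k + 1)⁆, F.x (2 * k + 3) (2 * k + 2)⁆ ≠ 0 := by
  have hy : F.w (2 * k + 3) * (F.e (2 * k) * F.e (2 * k + 1) * F.e (2 * k + 2) * F.ε) =
      F.e (2 * k) * F.e (2 * k + 1) * F.e (2 * k + 2) * F.ε := by
    simp only [← mul_assoc]
    rw [w_e, mul_assoc (F.e (2 * k)), w_e, ← mul_assoc, mul_assoc (F.e (2 * k) * _), w_e,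
      ← mul_assoc, mul_assoc _ (F.w _), F.w_ε h3]
  rw [F.lie_lie_x h3 (by omega), F.prod_lie_mul h3 (by omega) hy]
  have hne := F.eProd_mul_ε_ne_zero (2 * k + 3)
  simp only [eProd_succ, mul_assoc] at hne ⊢
  rcases neg_one_pow_eq_or B k with hs | hs <;> simpa [hs] using hne

end Fermions

/-! ### The order of `v k` modulo `T4` -/

theorem mk'_T4_eq_zero_iff (f : FreeRing) : T4.ringCon.mk' f = 0 ↔ f ∈ T4 := by
  rw [TwoSidedIdeal.mem_iff, ← RingCon.eq]
  exact Iff.rfl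

theorem three_mul_v_mem (k : ℕ) (hk : 1 ≤ k) : 3 * v k ∈ T4 := by
  let π := T4.ringCon.mk'
  have hπ (f : FreeRing) : π f = 0 ↔ f ∈ T4 := mk'_T4_eq_zero_iff f
  have hQ (a b c d : T4.ringCon.Quotient) : ⁅⁅⁅a, b⁆, c⁆, d⁆ = 0 := by
    obtain ⟨a, rfl⟩ := RingCon.mk'_surjective T4.ringCon a
    obtain ⟨b, rfl⟩ := RingCon.mk'_surjective T4.ringCon b
    obtain ⟨c, rfl⟩ := RingCon.mk'_surjective T4.ringCon c
    obtain ⟨d, rfl⟩ := RingCon.mk'_surjective T4.ringCon d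
    have h := (hπ ⁅⁅⁅a, b⁆, c⁆, d⁆).2 (TwoSidedIdeal.subset_span ⟨a, b, c, d, rfl⟩)
    simpa only [Ring.lie_def, map_sub, map_mul] using h
  -- Only the last of the simple commutators is needed besides the triple commutator.
  obtain ⟨m, rfl⟩ : ∃ m, k = m + 1 := ⟨k - 1, by omega⟩
  have key (p a b c d e : FreeRing) : 3 * (p * ⁅a, b⁆ * ⁅⁅c, d⁆, e⁆) ∈ T4 := by
    have h := three_mul_lie_mul_lie_lie hQ (π a) (π b) (π c) (π d) (π e)
    have h' : 3 * (⁅a, b⁆ * ⁅⁅c, d⁆, e⁆) ∈ T4 := by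
      rw [← hπ]
      simpa only [Ring.lie_def, map_sub, map_mul, map_ofNat] using h
    have h'' := T4.mul_mem_left p _ h'
    rwa [← mul_assoc, (Commute.ofNat_right p 3).eq, mul_assoc, ← mul_assoc p] at h''
  rw [v, List.range_succ, List.map_append, List.prod_append]
  simp only [List.map_cons, List.map_nil, List.prod_cons, List.prod_nil, mul_one]
  exact key _ _ _ _ _ _

theorem v_notMem (k : ℕ) : v k ∉ T4 := by
  let F := cliffordFermions Idx
  have := nontrivial_clifford Idx
  have h3 := three_eq_zero_clifford Idx
  let φ := FreeAlgebra.lift ℤ fun i : ℕ+ => F.x (2 * k + 3) i.natPred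
  have hφ (i : ℕ) : φ (x i.succPNat) = F.x (2 * k + 3) i := by
    simp [φ, x]
  have hT : T4 ≤ TwoSidedIdeal.ker φ := by
    rw [T4, TwoSidedIdeal.span_le]
    rintro _ ⟨a, b, c, d, rfl⟩
    exact (TwoSidedIdeal.mem_ker φ).2 (DifferentialPair.lift_lie_lie_lie (F.ε_ε h3)
      (fun i => F.ε_x h3 _ _) (fun i : ℕ+ => F.ε_dx h3 (2 * k + 3) i.natPred)
      (fun i j => F.compat_x h3 _ _ _) a b c d)
  intro hv
  have h0 := (TwoSidedIdeal.mem_ker φ).1 (hT hv)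
  apply F.prod_lie_mul_lie_lie_ne_zero h3 k
  have hlie (a b : FreeRing) : φ ⁅a, b⁆ = ⁅φ a, φ b⁆ := by
    simp only [Ring.lie_def, map_sub, map_mul]
  rw [← h0, v, map_mul, map_list_prod, List.map_map]
  simp only [Function.comp_def, hlie, hφ]

end LieNilpotent

theorem theorem1p1 (k : ℕ) (hk : 1 ≤ k) :
    LieNilpotent.v k ∉ LieNilpotent.T4 ∧
    3 * LieNilpotent.v k ∈ LieNilpotent.T4 ∧
    addOrderOf (LieNilpotent.T4.ringCon.mk' (LieNilpotent.v k)) = 3 := by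
  have h1 := LieNilpotent.v_notMem k
  have h2 := LieNilpotent.three_mul_v_mem k hk
  refine ⟨h1, h2, addOrderOf_eq_prime ?_ fun h => h1 ((LieNilpotent.mk'_T4_eq_zero_iff _).1 h)⟩
  rw [← map_nsmul, LieNilpotent.mk'_T4_eq_zero_iff, nsmul_eq_mul]
  exact h2
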